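/- Let $D\subseteq\mathbb R$, let $\alpha$ be an interior point of $D$, and let $f:D\to\mathbb R$ be sufficiently differentiable ($f\in C^8(D)$ is enough), with a simple root at $\alpha$: $f(\alpha)=0\neq f'(\alpha)$. Write $f[a,b]=\frac{f(a)-f(b)}{a-b}$ for $a\ne b$ and $f[a,a]=f'(a)$, and put $c_k=\frac{f^{(k)}(\alpha)}{k!\,f'(\alpha)}$. Given weight functions $G,H$, consider the iteration $$z_n=x_n+f(x_n)^3,\qquad y_n=x_n-\frac{f(x_n)}{f[z_n,x_n]},\qquad w_n=y_n-G(t_1)\frac{f(y_n)}{f[x_n,y_n]},\qquad x_{n+1}=w_n-H(t_2)\frac{f(w_n)}{f[w_n,y_n]},$$ where $t_1=\frac{f(y_n)}{f(x_n)}$ and $t_2=\frac{f[w_n,y_n]}{f[w_n,x_n]}$; the iteration stays at $\alpha$ once $x_n=\alpha$. Suppose that $G$ is three times differentiable at $0$ and $H$ is four times differentiable at $1$ (with finite derivatives), and $$G(0)=1,\quad G'(0)=1,\qquad H(1)=1,\quad H'(1)=0,\quad H''(1)=2,\quad H'''(1)=-12.$$ Put $$\zeta=\tfrac1{48}\,c_2\bigl(2c_3+c_2^2(G''(0)-6)\bigr)\Bigl(24c_3^2-24c_2\bigl(f'(\alpha)^3c_2+4c_2^3+c_4\bigr)+c_2^4H^{(4)}(1)\Bigr).$$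 1. With $e_n=x_n-\alpha$, one step of the method satisfies $e_{n+1}=\zeta e_n^8+o(e_n^8)$ as $e_n\to0$, and even $e_{n+1}=\zeta e_n^8+O(e_n^9)$ if $H$ is five times differentiable at $1$. 2. There are $\delta>0$ and $K$ such that, for every $x_0$ with $|x_0-\alpha|<\delta$: the iteration is well defined (all points $x_n,z_n,y_n,w_n$ lie in $D$; $f(x_n)=0$ only if $x_n=\alpha$; the divided differences $f[z_n,x_n]$, $f[x_n,y_n]$, $f[w_n,x_n]$, $f[w_n,y_n]$ are nonzero; $z_n,y_n,w_n\ne x_n$ if $f(x_n)\neq0$, and $w_n\neq y_n$ if $f(y_n)\ne0$); $x_n\to\alpha$; and $|x_{n+1}-\alpha|\le K|x_n-\alpha|^8$ for all $n$. If $x_n\neq\alpha$ for all $n$, then $$\lim_{n\to\infty}\frac{x_{n+1}-\alpha}{(x_n-\alpha)^8}=\zeta .$$ If $\zeta\ne0$ and $x_0\neq\alpha$, then $x_n\ne\alpha$ for all $n$, so that the order of convergence is exactly eight with asymptotic error constant $\zeta$. -/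

import Mathlib

open Filter Topology Asymptotics

namespace SteffensenEight

/-- `g` is `n` times differentiable at `a`: the derivatives of order less than `n - 1` are
differentiable near `a` and the one of order `n - 1` is differentiable at `a`, so that the
derivative of order `n` exists at `a` as a (finite) real number. -/
def TimesDifferentiableAt (n : ℕ) (g : ℝ → ℝ) (a : ℝ) : Prop :=
  ∀ k < n, DifferentiableAt ℝ (iteratedDeriv k g) a ∧
    (k + 1 < n → ∀ᶠ t in 𝓝 a, DifferentiableAt ℝ (iteratedDeriv k g) t)

/-- The divided difference `f[a, b] = (f a - f b) / (a - b)`, with the usual confluent value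
`f[a, a] = f' a`. -/
noncomputable def divDiff (f : ℝ → ℝ) (a b : ℝ) : ℝ := dslope f a b

/-- `z = x + f(x)^3`. -/
noncomputable def zStep (f : ℝ → ℝ) (x : ℝ) : ℝ := x + f x ^ 3

/-- `y = x - f(x) / f[z, x]`. -/
noncomputable def yStep (f : ℝ → ℝ) (x : ℝ) : ℝ := x - f x / divDiff f (zStep f x) x

/-- `t₁ = f(y) / f(x)`. -/
noncomputable def t₁ (f : ℝ → ℝ) (x : ℝ) : ℝ := f (yStep f x) / f x

/-- `w = y - G(t₁) f(y) / f[x, y]`. -/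
noncomputable def wStep (f G : ℝ → ℝ) (x : ℝ) : ℝ :=
  yStep f x - G (t₁ f x) * (f (yStep f x) / divDiff f x (yStep f x))

/-- `t₂ = f[w, y] / f[w, x]`. -/
noncomputable def t₂ (f G : ℝ → ℝ) (x : ℝ) : ℝ :=
  divDiff f (wStep f G x) (yStep f x) / divDiff f (wStep f G x) x

/-- One full step of the method: `x₊ = w - H(t₂) f(w) / f[w, y]`. -/
noncomputable def step (f G H : ℝ → ℝ) (x : ℝ) : ℝ :=
  wStep f G x -
    H (t₂ f G x) * (f (wStep f G x) / divDiff f (wStep f G x) (yStep f x))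

/-- One step from `x` makes sense for a function with domain `D`: the points where `f` is
evaluated lie in `D`, no divided difference that is divided by vanishes, and, unless a root of
`f` has already been reached, the two nodes of each divided difference are different. -/
def StepDefined (D : Set ℝ) (f G : ℝ → ℝ) (x : ℝ) : Prop :=
  (x ∈ D ∧ zStep f x ∈ D ∧ yStep f x ∈ D ∧ wStep f G x ∈ D) ∧
  (divDiff f (zStep f x) x ≠ 0 ∧ divDiff f x (yStep f x) ≠ 0 ∧
    divDiff f (wStep f G x) x ≠ 0 ∧ divDiff f (wStep f G x) (yStep f x) ≠ 0) ∧
  (f x ≠ 0 → zStep f x ≠ x ∧ yStep f x ≠ x ∧ wStep f G x ≠ x) ∧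
  (f (yStep f x) ≠ 0 → wStep f G x ≠ yStep f x)

/-- `c_k = f^(k)(α) / (k! f'(α))`. -/
noncomputable def coeff (f : ℝ → ℝ) (α : ℝ) (k : ℕ) : ℝ :=
  iteratedDeriv k f α / (k.factorial * deriv f α)

/-- The coefficient of `(x - α)^8` in the error of one step. -/
noncomputable def errorConst (f G H : ℝ → ℝ) (α : ℝ) : ℝ :=
  1 / 48 * coeff f α 2 *
    (2 * coeff f α 3 + coeff f α 2 ^ 2 * (-6 + iteratedDeriv 2 G 0)) *
    (24 * coeff f α 3 ^ 2
      - 24 * coeff f α 2 * (deriv f α ^ 3 * coeff f α 2 + 4 * coeff f α 2 ^ 3 + coeff f α 4)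
      + coeff f α 2 ^ 4 * iteratedDeriv 4 H 1)

/-- The sequence `x` converges to `α` with order `m` and asymptotic error constant `ζ ≠ 0`. -/
def HasConvergenceOrder (x : ℕ → ℝ) (α : ℝ) (m : ℕ) (ζ : ℝ) : Prop :=
  Tendsto x atTop (𝓝 α) ∧ ζ ≠ 0 ∧ (∀ n, x n ≠ α) ∧
    Tendsto (fun n => (x (n + 1) - α) / (x n - α) ^ m) atTop (𝓝 ζ)

end SteffensenEight

namespace SteffensenEight

/-! ### Taylor's formula with Peano's remainder -/

/-! Since `f α = 0`, one has `f s = (s - α) * f[s, α]` for every `s`. Each of the three stages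
therefore multiplies the current error exactly by a factor of the form 1 - (weight) * (quotient of
two divided differences). With `e = x - α`, the new error is `e` times the product of three such
factors, and these behave like `c₂ e`, `B e^2` and `C e^4`, so that the error constant is `c₂ B C`.
Because the orders multiply, no factor is needed beyond its own leading term, and expansions with
remainder `O(e^5)` suffice for an error equation of order eight.

The conditions on the weights produce the cancellations. In the second stage the quotient is `1 - c₂
e + ⋯` while `t₁ = c₂ e + ⋯`, so `G(0) = G'(0) = 1` removes the terms of order zero and one. In the
third stage the quotient is `1 - c₂^2 e^2 + ⋯` while `t₂ - 1 = -c₂ e + ⋯`, and the prescribed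
derivatives of `H` up to the third remove everything below `e^4`. As `z - x = f(x)^3` is of order
`e^3`, it enters only through the term `f'(α)^3 c₂` in the constant.

The analytic core is `exists_abs_divDiff_sub_le`, a bound uniform in the two nodes, including
coincident ones. With `HasExpansion.divDiff_comp` it reduces the rest to arithmetic of truncated
polynomials; `wFactor_isBigO` and `stepFactor_add_isBigO` carry out the two cancellations. Local
convergence is then a contraction argument in `exists_local_convergence`. -/

theorem TimesDifferentiableAt.mono {m n : ℕ} {g : ℝ → ℝ} {a : ℝ}
    (h : TimesDifferentiableAt n g a) (hmn : m ≤ n) : TimesDifferentiableAt m g a :=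
  fun k hk => ⟨(h k (hk.trans_le hmn)).1, fun hk' => (h k (hk.trans_le hmn)).2 (hk'.trans_le hmn)⟩

theorem TimesDifferentiableAt.deriv {n : ℕ} {g : ℝ → ℝ} {a : ℝ}
    (h : TimesDifferentiableAt (n + 1) g a) : TimesDifferentiableAt n (deriv g) a := by
  intro k hk
  have := h (k + 1) (by omega)
  rw [iteratedDeriv_succ'] at this
  exact ⟨this.1, fun hk' => this.2 (by omega)⟩

/-- If `h' = o((x - a)^n)` and `h a = 0`, then `h = o((x - a)^(n + 1))`. -/
theorem isLittleO_pow_succ_of_deriv {h : ℝ → ℝ} {a : ℝ} {n : ℕ}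
    (hd : ∀ᶠ x in 𝓝 a, DifferentiableAt ℝ h x) (h0 : h a = 0)
    (ho : deriv h =o[𝓝 a] fun x => (x - a) ^ n) :
    h =o[𝓝 a] fun x => (x - a) ^ (n + 1) := by
  rw [isLittleO_iff]
  intro c hc
  obtain ⟨ε, hε, hball⟩ := Metric.eventually_nhds_iff_ball.1 (hd.and (isLittleO_iff.1 ho hc))
  filter_upwards [Metric.ball_mem_nhds a hε] with x hx
  -- The mean value inequality is applied on the ball of radius `|x - a|`, where `|t - a|^n ≤ |x -
  -- a|^n`; the length `|x - a|` of the segment supplies the extra power.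
  have hsub : ∀ t ∈ Metric.closedBall a |x - a|, t ∈ Metric.ball a ε := fun t ht =>
    lt_of_le_of_lt (Metric.mem_closedBall.1 ht) (by simpa [Real.dist_eq] using hx)
  have := (convex_closedBall a |x - a|).norm_image_sub_le_of_norm_deriv_le (f := h)
    (C := c * |x - a| ^ n) (fun t ht => (hball t (hsub t ht)).1)
    (fun t ht => (hball t (hsub t ht)).2.trans (by
      rw [norm_pow, Real.norm_eq_abs]
      have : |t - a| ≤ |x - a| := by simpa [Real.dist_eq] using ht
      gcongr))
    (Metric.mem_closedBall_self (abs_nonneg _)) (y := x) (by simp [Real.dist_eq])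
  rw [h0, sub_zero, Real.norm_eq_abs (x - a)] at this
  rw [norm_pow, Real.norm_eq_abs (x - a), pow_succ, ← mul_assoc]
  exact this

/-- **Taylor's formula with Peano's remainder** for a function that is merely `n + 1` times
differentiable at a point. -/
theorem TimesDifferentiableAt.taylor_isLittleO {n : ℕ} {g : ℝ → ℝ} {a : ℝ}
    (h : TimesDifferentiableAt (n + 1) g a) :
    (fun x => g x - ∑ k ∈ Finset.range (n + 2),
      iteratedDeriv k g a / k.factorial * (x - a) ^ k) =o[𝓝 a] fun x => (x - a) ^ (n + 1) := by
  induction n generalizing g with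
  | zero =>
    have hg : DifferentiableAt ℝ g a := by simpa using (h 0 (by omega)).1
    have := hasDerivAt_iff_isLittleO.1 hg.hasDerivAt
    simp only [Finset.sum_range_succ, Finset.range_zero, Finset.sum_empty]
    simpa [sub_sub, mul_comm] using this
  | succ n ih =>
    have hg : ∀ᶠ x in 𝓝 a, DifferentiableAt ℝ g x := by
      simpa using (h 0 (by omega)).2 (by omega)
    have hpoly : ∀ x, HasDerivAt (fun x => ∑ k ∈ Finset.range (n + 3),
        iteratedDeriv k g a / k.factorial * (x - a) ^ k)
        (∑ k ∈ Finset.range (n + 2),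
          iteratedDeriv k (_root_.deriv g) a / k.factorial * (x - a) ^ k) x := by
      intro x
      have h1 := HasDerivAt.fun_sum (u := Finset.range (n + 3)) (fun k _ =>
        (((hasDerivAt_id x).sub_const a).fun_pow k).const_mul (iteratedDeriv k g a / k.factorial))
      refine h1.congr_deriv ?_
      rw [Finset.sum_range_succ' _ (n + 2)]
      simp only [CharP.cast_eq_zero, zero_mul, mul_zero, add_zero]
      refine Finset.sum_congr rfl fun k _ => ?_
      rw [iteratedDeriv_succ', Nat.factorial_succ]
      have : (k.factorial : ℝ) ≠ 0 := by positivity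
      have : (k : ℝ) + 1 ≠ 0 := by positivity
      push_cast
      simp only [id]
      field_simp
    -- The derivative of the Taylor remainder of `g` is the Taylor remainder of `g'` of one order
    -- less, to which the induction hypothesis applies.
    refine isLittleO_pow_succ_of_deriv ?_ ?_ ((ih h.deriv).congr' ?_ EventuallyEq.rfl)
    · filter_upwards [hg] with x hx using hx.fun_sub (hpoly x).differentiableAt
    · rw [Finset.sum_range_succ' _ (n + 2)]
      simp
    · filter_upwards [hg] with x hx
      exact (hx.hasDerivAt.fun_sub (hpoly x)).deriv.symm

theorem _root_.ContDiffAt.timesDifferentiableAt {n : ℕ} {g : ℝ → ℝ} {a : ℝ}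
    (h : ContDiffAt ℝ n g a) : TimesDifferentiableAt n g a := by
  have key : ∀ k < n, ∀ᶠ t in 𝓝 a, DifferentiableAt ℝ (iteratedDeriv k g) t := by
    intro k hk
    filter_upwards [h.eventually (by simp)] with t ht
    rw [iteratedDeriv_eq_equiv_comp, LinearIsometryEquiv.comp_differentiableAt_iff]
    exact ht.differentiableAt_iteratedFDeriv (by exact_mod_cast hk)
  exact fun k hk => ⟨(key k hk).self_of_nhds, fun _ => key k hk⟩

/-! ### Expansions up to the fifth order -/

/-- `u x = a₀ + a₁ (x - α) + ⋯ + a₄ (x - α)^4 + O((x - α)^5)` as `x → α`. -/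
def HasExpansion (α : ℝ) (u : ℝ → ℝ) (a₀ a₁ a₂ a₃ a₄ : ℝ) : Prop :=
  (fun x => u x - (a₀ + a₁ * (x - α) + a₂ * (x - α) ^ 2 + a₃ * (x - α) ^ 3 + a₄ * (x - α) ^ 4))
    =O[𝓝 α] fun x => (x - α) ^ 5

theorem tendsto_sub_self (α : ℝ) : Tendsto (fun x : ℝ => x - α) (𝓝 α) (𝓝 0) := by
  have : Continuous fun x : ℝ => x - α := by fun_prop
  simpa using this.tendsto α

theorem isBigO_sub_pow {α : ℝ} {m n : ℕ} (h : m ≤ n) :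
    (fun x : ℝ => (x - α) ^ n) =O[𝓝 α] fun x => (x - α) ^ m := by
  obtain ⟨k, rfl⟩ := Nat.exists_eq_add_of_le h
  have h1 : (fun x : ℝ => (x - α) ^ k) =O[𝓝 α] fun _ => (1 : ℝ) :=
    ((tendsto_sub_self α).pow k).isBigO_one ℝ
  simpa [pow_add] using (isBigO_refl (fun x : ℝ => (x - α) ^ m) (𝓝 α)).mul h1

theorem isBigO_pow_mul_of_continuous {α : ℝ} {n : ℕ} {q : ℝ → ℝ} (hq : Continuous q) :
    (fun x : ℝ => (x - α) ^ n * q x) =O[𝓝 α] fun x => (x - α) ^ n := by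
  simpa using (isBigO_refl (fun x : ℝ => (x - α) ^ n) (𝓝 α)).mul ((hq.tendsto α).isBigO_one ℝ)

namespace HasExpansion

variable {α : ℝ} {u v : ℝ → ℝ} {a₀ a₁ a₂ a₃ a₄ b₀ b₁ b₂ b₃ b₄ c₀ c₁ c₂ c₃ c₄ : ℝ}

theorem congr_coeff (h : HasExpansion α u a₀ a₁ a₂ a₃ a₄) (h₀ : a₀ = b₀) (h₁ : a₁ = b₁)
    (h₂ : a₂ = b₂) (h₃ : a₃ = b₃) (h₄ : a₄ = b₄) : HasExpansion α u b₀ b₁ b₂ b₃ b₄ := by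
  subst_vars; exact h

theorem congr_fun (h : HasExpansion α u a₀ a₁ a₂ a₃ a₄) (huv : ∀ x, v x = u x) :
    HasExpansion α v a₀ a₁ a₂ a₃ a₄ := by
  rwa [show v = u from funext huv]

theorem poly (α a₀ a₁ a₂ a₃ a₄ : ℝ) :
    HasExpansion α (fun x => a₀ + a₁ * (x - α) + a₂ * (x - α) ^ 2 + a₃ * (x - α) ^ 3
      + a₄ * (x - α) ^ 4) a₀ a₁ a₂ a₃ a₄ := by
  simpa [HasExpansion] using isBigO_zero _ _

theorem const (α c : ℝ) : HasExpansion α (fun _ => c) c 0 0 0 0 :=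
  (poly α c 0 0 0 0).congr_fun fun x => by ring

theorem sub_self (α : ℝ) : HasExpansion α (fun x => x - α) 0 1 0 0 0 :=
  (poly α 0 1 0 0 0).congr_fun fun x => by ring

theorem add (hu : HasExpansion α u a₀ a₁ a₂ a₃ a₄) (hv : HasExpansion α v b₀ b₁ b₂ b₃ b₄) :
    HasExpansion α (fun x => u x + v x) (a₀ + b₀) (a₁ + b₁) (a₂ + b₂) (a₃ + b₃) (a₄ + b₄) :=
  (IsBigO.add hu hv).congr_left fun x => by ring

theorem sub (hu : HasExpansion α u a₀ a₁ a₂ a₃ a₄) (hv : HasExpansion α v b₀ b₁ b₂ b₃ b₄) :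
    HasExpansion α (fun x => u x - v x) (a₀ - b₀) (a₁ - b₁) (a₂ - b₂) (a₃ - b₃) (a₄ - b₄) :=
  (IsBigO.sub hu hv).congr_left fun x => by ring

theorem tendsto (hu : HasExpansion α u a₀ a₁ a₂ a₃ a₄) : Tendsto u (𝓝 α) (𝓝 a₀) := by
  have h5 : Tendsto (fun x : ℝ => (x - α) ^ 5) (𝓝 α) (𝓝 0) := by
    simpa using (tendsto_sub_self α).pow 5
  have hp : Continuous fun x : ℝ => a₀ + a₁ * (x - α) + a₂ * (x - α) ^ 2 + a₃ * (x - α) ^ 3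
      + a₄ * (x - α) ^ 4 := by fun_prop
  simpa using (IsBigO.trans_tendsto hu h5).add (hp.tendsto α)

theorem isBigO_one (hu : HasExpansion α u a₀ a₁ a₂ a₃ a₄) : u =O[𝓝 α] fun _ => (1 : ℝ) :=
  hu.tendsto.isBigO_one ℝ

theorem mul (hu : HasExpansion α u a₀ a₁ a₂ a₃ a₄) (hv : HasExpansion α v b₀ b₁ b₂ b₃ b₄) :
    HasExpansion α (fun x => u x * v x) (a₀ * b₀) (a₀ * b₁ + a₁ * b₀)
      (a₀ * b₂ + a₁ * b₁ + a₂ * b₀) (a₀ * b₃ + a₁ * b₂ + a₂ * b₁ + a₃ * b₀)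
      (a₀ * b₄ + a₁ * b₃ + a₂ * b₂ + a₃ * b₁ + a₄ * b₀) := by
  -- With `p`, `q` the truncations of `u`, `v`: `u v - p q = (u - p) v + p (v - q)`, and `h3`
  -- collects the terms of `p q` of degree at least five.
  have h1 := IsBigO.mul hu hv.isBigO_one
  have h2 := IsBigO.mul (poly α a₀ a₁ a₂ a₃ a₄).isBigO_one hv
  have h3 := isBigO_pow_mul_of_continuous (α := α) (n := 5)
    (q := fun x => (a₁ * b₄ + a₂ * b₃ + a₃ * b₂ + a₄ * b₁)
      + (a₂ * b₄ + a₃ * b₃ + a₄ * b₂) * (x - α) + (a₃ * b₄ + a₄ * b₃) * (x - α) ^ 2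
      + a₄ * b₄ * (x - α) ^ 3) (by fun_prop)
  simp only [mul_one, one_mul] at h1 h2
  exact ((h1.add h2).add h3).congr_left fun x => by ring

theorem inv_isBigO_one (hv : HasExpansion α v 1 b₁ b₂ b₃ b₄) :
    (fun x => (v x)⁻¹) =O[𝓝 α] fun _ => (1 : ℝ) :=
  (hv.tendsto.inv₀ one_ne_zero).isBigO_one ℝ

theorem eventually_ne_zero (hv : HasExpansion α v 1 b₁ b₂ b₃ b₄) : ∀ᶠ x in 𝓝 α, v x ≠ 0 :=
  hv.tendsto.eventually_ne one_ne_zero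

/-- The difference `u - v * (c₀ + ⋯ + c₄ (x - α)^4)` has vanishing coefficients, and `1 / v` is
bounded near `α`. The quotient's coefficients are supplied and checked by multiplying back;
normalising `v` to constant term 1 keeps these checks polynomial, hence within reach of `ring`. -/
theorem div (hu : HasExpansion α u a₀ a₁ a₂ a₃ a₄) (hv : HasExpansion α v 1 b₁ b₂ b₃ b₄)
    (h₀ : a₀ = c₀) (h₁ : a₁ = c₁ + b₁ * c₀) (h₂ : a₂ = c₂ + b₁ * c₁ + b₂ * c₀)
    (h₃ : a₃ = c₃ + b₁ * c₂ + b₂ * c₁ + b₃ * c₀)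
    (h₄ : a₄ = c₄ + b₁ * c₃ + b₂ * c₂ + b₃ * c₁ + b₄ * c₀) :
    HasExpansion α (fun x => u x / v x) c₀ c₁ c₂ c₃ c₄ := by
  have h := (hu.sub (hv.mul (poly α c₀ c₁ c₂ c₃ c₄))).congr_coeff (b₀ := 0) (b₁ := 0) (b₂ := 0)
    (b₃ := 0) (b₄ := 0) (by rw [h₀]; ring) (by rw [h₁]; ring) (by rw [h₂]; ring)
    (by rw [h₃]; ring) (by rw [h₄]; ring)
  have h' := IsBigO.mul h hv.inv_isBigO_one
  simp only [mul_one] at h'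
  refine h'.congr' ?_ EventuallyEq.rfl
  filter_upwards [hv.eventually_ne_zero] with x hx
  field_simp
  ring

theorem isBigO_sub_self (hu : HasExpansion α u 0 a₁ a₂ a₃ a₄) :
    u =O[𝓝 α] fun x => x - α := by
  have h1 := hu.trans (isBigO_sub_pow (α := α) (m := 1) (n := 5) (by norm_num))
  have h2 := isBigO_pow_mul_of_continuous (α := α) (n := 1)
    (q := fun x => a₁ + a₂ * (x - α) + a₃ * (x - α) ^ 2 + a₄ * (x - α) ^ 3) (by fun_prop)
  simpa using (h1.add h2).congr_left (f₂ := u) fun x => by ring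

theorem isBigO_sub_two (hu : HasExpansion α u 0 0 a₂ a₃ a₄) :
    (fun x => u x - a₂ * (x - α) ^ 2) =O[𝓝 α] fun x => (x - α) ^ 3 := by
  have h1 := hu.trans (isBigO_sub_pow (α := α) (m := 3) (n := 5) (by norm_num))
  have h2 := isBigO_pow_mul_of_continuous (α := α) (n := 3)
    (q := fun x => a₃ + a₄ * (x - α)) (by fun_prop)
  exact (h1.add h2).congr_left fun x => by ring

theorem isBigO_sub_four (hu : HasExpansion α u 0 0 0 0 a₄) :
    (fun x => u x - a₄ * (x - α) ^ 4) =O[𝓝 α] fun x => (x - α) ^ 5 :=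
  IsBigO.congr_left hu fun x => by ring

end HasExpansion

/-! ### Divided differences near the root -/

theorem deriv_isBigO {f : ℝ → ℝ} {α : ℝ} (hf : TimesDifferentiableAt 6 f α)
    (hF : deriv f α ≠ 0) :
    (fun x => deriv f x - deriv f α * (1 + 2 * coeff f α 2 * (x - α)
      + 3 * coeff f α 3 * (x - α) ^ 2 + 4 * coeff f α 4 * (x - α) ^ 3
      + 5 * coeff f α 5 * (x - α) ^ 4)) =O[𝓝 α] fun x => (x - α) ^ 5 := by
  have h1 := hf.deriv.taylor_isLittleO.isBigO
  -- The degree-five Taylor term of `f'` is absorbed into the remainder; this is where the sixth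
  -- derivative of `f` at `α` is used.
  have h2 := (isBigO_refl (fun x : ℝ => (x - α) ^ 5) (𝓝 α)).const_mul_left
    (iteratedDeriv 6 f α / 120)
  refine (h1.add h2).congr_left fun x => ?_
  simp only [Finset.sum_range_succ, Finset.range_zero, Finset.sum_empty, ← iteratedDeriv_succ',
    coeff, Nat.factorial]
  simp only [zero_add, iteratedDeriv_one]
  push_cast
  field_simp
  ring

/-- The divided difference `f[α + a, α + b]`, normalised by `f' α`, is a symmetric polynomial in
`a` and `b` up to terms of the fifth order. -/
theorem exists_abs_divDiff_sub_le {f : ℝ → ℝ} {α : ℝ} (hf : TimesDifferentiableAt 6 f α)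
    (hF : deriv f α ≠ 0) :
    ∃ C : ℝ, ∃ ε > 0, ∀ a b ρ : ℝ, ρ < ε → |a| ≤ ρ → |b| ≤ ρ →
      |divDiff f (α + a) (α + b) / deriv f α - (1 + coeff f α 2 * (a + b)
        + coeff f α 3 * (a ^ 2 + a * b + b ^ 2)
        + coeff f α 4 * (a ^ 3 + a ^ 2 * b + a * b ^ 2 + b ^ 3)
        + coeff f α 5 * (a ^ 4 + a ^ 3 * b + a ^ 2 * b ^ 2 + a * b ^ 3 + b ^ 4))| ≤ C * ρ ^ 5 := by
  obtain ⟨C, hC, hb⟩ := (deriv_isBigO hf hF).exists_pos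
  have hfd : ∀ᶠ x in 𝓝 α, DifferentiableAt ℝ f x := by
    simpa using (hf 0 (by norm_num)).2 (by norm_num)
  obtain ⟨ε, hε, hball⟩ := Metric.eventually_nhds_iff_ball.1 (hfd.and hb.bound)
  refine ⟨C / |deriv f α|, ε, hε, fun a b ρ hρ ha hb' => ?_⟩
  have hF' : 0 < |deriv f α| := abs_pos.2 hF
  -- `p` is the Taylor polynomial of `f` without its constant term, which no divided difference
  -- sees. The remainder is controlled through `f' - p'`, since dividing a bound for `f - p` by `a -
  -- b` would not be uniform as the nodes merge.
  set p : ℝ → ℝ := fun x => deriv f α * ((x - α) + coeff f α 2 * (x - α) ^ 2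
    + coeff f α 3 * (x - α) ^ 3 + coeff f α 4 * (x - α) ^ 4 + coeff f α 5 * (x - α) ^ 5) with hp
  have hpd : ∀ x, HasDerivAt p (deriv f α * (1 + 2 * coeff f α 2 * (x - α)
      + 3 * coeff f α 3 * (x - α) ^ 2 + 4 * coeff f α 4 * (x - α) ^ 3
      + 5 * coeff f α 5 * (x - α) ^ 4)) x := by
    intro x
    have hid : HasDerivAt (fun x : ℝ => x - α) 1 x := (hasDerivAt_id x).sub_const α
    have h1 := ((((hid.fun_add ((hid.fun_pow 2).const_mul (coeff f α 2))).fun_add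
      ((hid.fun_pow 3).const_mul (coeff f α 3))).fun_add
      ((hid.fun_pow 4).const_mul (coeff f α 4))).fun_add
      ((hid.fun_pow 5).const_mul (coeff f α 5))).const_mul (deriv f α)
    refine h1.congr_deriv ?_
    simp only [Nat.cast_ofNat, Nat.reduceSub]
    ring
  have hmem : ∀ t ∈ Metric.closedBall α ρ, t ∈ Metric.ball α ε := fun t ht =>
    lt_of_le_of_lt (Metric.mem_closedBall.1 ht) hρ
  have hr : ∀ t ∈ Metric.closedBall α ρ,
      HasDerivAt (fun x => f x - p x) (deriv f t - deriv f α * (1 + 2 * coeff f α 2 * (t - α)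
      + 3 * coeff f α 3 * (t - α) ^ 2 + 4 * coeff f α 4 * (t - α) ^ 3
      + 5 * coeff f α 5 * (t - α) ^ 4)) t := fun t ht =>
    (hball t (hmem t ht)).1.hasDerivAt.fun_sub (hpd t)
  have hbd : ∀ t ∈ Metric.closedBall α ρ, ‖deriv f t - deriv f α * (1 + 2 * coeff f α 2 * (t - α)
      + 3 * coeff f α 3 * (t - α) ^ 2 + 4 * coeff f α 4 * (t - α) ^ 3
      + 5 * coeff f α 5 * (t - α) ^ 4)‖ ≤ C * ρ ^ 5 := by
    intro t ht
    refine (hball t (hmem t ht)).2.trans ?_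
    rw [norm_pow, Real.norm_eq_abs]
    have : |t - α| ≤ ρ := by simpa [Real.dist_eq] using ht
    gcongr
  have hma : α + a ∈ Metric.closedBall α ρ := by simpa [Real.dist_eq] using ha
  have hmb : α + b ∈ Metric.closedBall α ρ := by simpa [Real.dist_eq] using hb'
  rw [div_mul_eq_mul_div, le_div_iff₀ hF', ← abs_mul, sub_mul, div_mul_cancel₀ _ hF]
  -- For equal nodes the claim is the bound on `f' - p'` itself; for distinct nodes the mean value
  -- inequality for `f - p` gives the same bound times `|b - a|`.
  rcases eq_or_ne a b with rfl | hab
  · have := hbd _ hma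
    rw [divDiff, dslope_same]
    rw [Real.norm_eq_abs, add_sub_cancel_left] at this
    refine le_trans (le_of_eq ?_) this
    congr 1
    ring
  · have h1 := (convex_closedBall α ρ).norm_image_sub_le_of_norm_hasDerivWithin_le
      (fun t ht => (hr t ht).hasDerivWithinAt) hbd hma hmb
    have hba : b - a ≠ 0 := sub_ne_zero.2 hab.symm
    rw [add_sub_add_left_eq_sub, Real.norm_eq_abs, Real.norm_eq_abs] at h1
    refine le_of_mul_le_mul_right ?_ (abs_pos.2 hba)
    rw [← abs_mul]
    refine le_trans (le_of_eq ?_) h1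
    congr 1
    rw [divDiff, dslope_of_ne _ (by simpa using hab.symm), slope_def_field,
      add_sub_add_left_eq_sub, sub_mul, div_mul_cancel₀ _ hba]
    simp only [hp]
    ring

/-- The expansion of a divided difference whose nodes have expansions. -/
theorem HasExpansion.divDiff_comp {f : ℝ → ℝ} {α : ℝ} (hf : TimesDifferentiableAt 6 f α)
    (hF : deriv f α ≠ 0) {u v : ℝ → ℝ} {a₁ a₂ a₃ a₄ b₁ b₂ b₃ b₄ : ℝ}
    (hu : HasExpansion α (fun x => u x - α) 0 a₁ a₂ a₃ a₄)
    (hv : HasExpansion α (fun x => v x - α) 0 b₁ b₂ b₃ b₄) :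
    HasExpansion α (fun x => divDiff f (u x) (v x) / deriv f α) 1
      (coeff f α 2 * (a₁ + b₁))
      (coeff f α 2 * (a₂ + b₂) + coeff f α 3 * (a₁ ^ 2 + a₁ * b₁ + b₁ ^ 2))
      (coeff f α 2 * (a₃ + b₃) + coeff f α 3 * (2 * a₁ * a₂ + a₁ * b₂ + a₂ * b₁ + 2 * b₁ * b₂)
        + coeff f α 4 * (a₁ ^ 3 + a₁ ^ 2 * b₁ + a₁ * b₁ ^ 2 + b₁ ^ 3))
      (coeff f α 2 * (a₄ + b₄)
        + coeff f α 3 * (2 * a₁ * a₃ + a₂ ^ 2 + a₁ * b₃ + a₂ * b₂ + a₃ * b₁ + 2 * b₁ * b₃ + b₂ ^ 2)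
        + coeff f α 4 * (3 * a₁ ^ 2 * a₂ + 2 * a₁ * a₂ * b₁ + a₁ ^ 2 * b₂ + a₂ * b₁ ^ 2
          + 2 * a₁ * b₁ * b₂ + 3 * b₁ ^ 2 * b₂)
        + coeff f α 5 * (a₁ ^ 4 + a₁ ^ 3 * b₁ + a₁ ^ 2 * b₁ ^ 2 + a₁ * b₁ ^ 3 + b₁ ^ 4)) := by
  obtain ⟨C, ε, hε, hC⟩ := exists_abs_divDiff_sub_le hf hF
  obtain ⟨M, hM⟩ := hu.isBigO_sub_self.bound
  obtain ⟨N, hN⟩ := hv.isBigO_sub_self.bound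
  -- `max M N * |x - α|` serves as the common radius `ρ` for the two nodes.
  have hlim : Tendsto (fun x => max M N * |x - α|) (𝓝 α) (𝓝 0) := by
    simpa using (tendsto_sub_self α).abs.const_mul (max M N)
  have hrem : (fun x => divDiff f (u x) (v x) / deriv f α
      - (1 + coeff f α 2 * ((u x - α) + (v x - α))
        + coeff f α 3 * ((u x - α) ^ 2 + (u x - α) * (v x - α) + (v x - α) ^ 2)
        + coeff f α 4 * ((u x - α) ^ 3 + (u x - α) ^ 2 * (v x - α) + (u x - α) * (v x - α) ^ 2
          + (v x - α) ^ 3)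
        + coeff f α 5 * ((u x - α) ^ 4 + (u x - α) ^ 3 * (v x - α)
          + (u x - α) ^ 2 * (v x - α) ^ 2 + (u x - α) * (v x - α) ^ 3 + (v x - α) ^ 4)))
      =O[𝓝 α] fun x => (x - α) ^ 5 := by
    refine IsBigO.of_bound (C * max M N ^ 5) ?_
    filter_upwards [hM, hN, hlim.eventually_lt_const hε] with x h1 h2 h3
    have h := hC (u x - α) (v x - α) _ h3
      (h1.trans (mul_le_mul_of_nonneg_right (le_max_left _ _) (norm_nonneg _)))
      (h2.trans (mul_le_mul_of_nonneg_right (le_max_right _ _) (norm_nonneg _)))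
    rw [add_sub_cancel, add_sub_cancel, mul_pow, ← mul_assoc, ← abs_pow] at h
    exact h
  have hu2 := hu.mul hu
  have hv2 := hv.mul hv
  have huv := hu.mul hv
  have h3 := ((hu2.add huv).add hv2)
  have h4 := (hu2.mul hu).add ((hu2.mul hv).add ((hu.mul hv2).add (hv2.mul hv)))
  have h5 := (hu2.mul hu2).add ((hu2.mul huv).add ((huv.mul huv).add
    ((huv.mul hv2).add (hv2.mul hv2))))
  have hq := (((((HasExpansion.const α 1).add
    ((HasExpansion.const α (coeff f α 2)).mul (hu.add hv))).add
    ((HasExpansion.const α (coeff f α 3)).mul h3)).add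
    ((HasExpansion.const α (coeff f α 4)).mul h4)).add
    ((HasExpansion.const α (coeff f α 5)).mul h5))
  have hq' := IsBigO.add hrem hq
  exact hq'.congr_left fun x => by ring

/-! ### The stages of one step -/

/-- The divided difference of `f` normalised by `f' α`. -/
noncomputable def normDivDiff (f : ℝ → ℝ) (α s t : ℝ) : ℝ := divDiff f s t / deriv f α

/-- The factor by which the first stage multiplies the error. -/
noncomputable def yFactor (f : ℝ → ℝ) (α x : ℝ) : ℝ :=
  1 - normDivDiff f α x α / normDivDiff f α (zStep f x) x

/-- The factor by which the second stage multiplies the error. -/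
noncomputable def wFactor (f G : ℝ → ℝ) (α x : ℝ) : ℝ :=
  1 - G (t₁ f x) * (normDivDiff f α (yStep f x) α / normDivDiff f α x (yStep f x))

/-- The factor by which the third stage multiplies the error. -/
noncomputable def stepFactor (f G H : ℝ → ℝ) (α x : ℝ) : ℝ :=
  1 - H (t₂ f G x) *
    (normDivDiff f α (wStep f G x) α / normDivDiff f α (wStep f G x) (yStep f x))

section Stages

variable {f G H : ℝ → ℝ} {α : ℝ}

/-! ### Exact factorisation of the errors -/

/-- At a root, `f x` is itself a divided difference times the error. This makes the stage identities
below exact and valid for every `x`, including `x = α`. -/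
theorem eq_mul_normDivDiff (hroot : f α = 0) (hF : deriv f α ≠ 0) (x : ℝ) :
    f x = deriv f α * ((x - α) * normDivDiff f α x α) := by
  have h := sub_smul_dslope f x α
  rw [hroot, smul_eq_mul] at h
  rw [normDivDiff, divDiff]
  field_simp
  linarith

theorem yStep_sub_eq (hroot : f α = 0) (hF : deriv f α ≠ 0) (x : ℝ) :
    yStep f x - α = (x - α) * yFactor f α x := by
  have h := eq_mul_normDivDiff hroot hF x
  have h' : f x / divDiff f (zStep f x) x
      = (x - α) * (normDivDiff f α x α / normDivDiff f α (zStep f x) x) := by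
    rw [h, ← mul_div_assoc, normDivDiff, normDivDiff, div_div_eq_mul_div]
    congr 1
    field_simp
  rw [yStep, h', yFactor]
  ring

theorem wStep_sub_eq (hroot : f α = 0) (hF : deriv f α ≠ 0) (x : ℝ) :
    wStep f G x - α = (yStep f x - α) * wFactor f G α x := by
  have h := eq_mul_normDivDiff hroot hF (yStep f x)
  have h' : f (yStep f x) / divDiff f x (yStep f x) = (yStep f x - α) *
      (normDivDiff f α (yStep f x) α / normDivDiff f α x (yStep f x)) := by
    rw [h, ← mul_div_assoc, normDivDiff, normDivDiff, div_div_eq_mul_div]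
    congr 1
    field_simp
  rw [wStep, h', wFactor]
  ring

theorem step_sub_eq (hroot : f α = 0) (hF : deriv f α ≠ 0) (x : ℝ) :
    step f G H x - α = (wStep f G x - α) * stepFactor f G H α x := by
  have h := eq_mul_normDivDiff hroot hF (wStep f G x)
  have h' : f (wStep f G x) / divDiff f (wStep f G x) (yStep f x) = (wStep f G x - α) *
      (normDivDiff f α (wStep f G x) α / normDivDiff f α (wStep f G x) (yStep f x)) := by
    rw [h, ← mul_div_assoc, normDivDiff, normDivDiff, div_div_eq_mul_div]
    congr 1
    field_simp
  rw [step, h', stepFactor]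
  ring

theorem t₁_eq (hroot : f α = 0) (hF : deriv f α ≠ 0) (x : ℝ) :
    t₁ f x = yFactor f α x * (normDivDiff f α (yStep f x) α / normDivDiff f α x α) := by
  rw [t₁, eq_mul_normDivDiff hroot hF x, eq_mul_normDivDiff hroot hF (yStep f x),
    yStep_sub_eq hroot hF]
  -- At the root, `t₁` is `0 / 0 = 0`, and the right-hand side vanishes as well because `z = x`
  -- makes `yFactor` zero.
  rcases eq_or_ne x α with rfl | hx
  · have hz : zStep f x = x := by simp [zStep, hroot]
    have hx : normDivDiff f x x x = 1 := by
      rw [normDivDiff, divDiff, dslope_same, div_self hF]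
    simp [yFactor, hz, hx]
  · have hx' : x - α ≠ 0 := sub_ne_zero.2 hx
    rw [mul_div_mul_left _ _ hF, mul_assoc (x - α), mul_div_mul_left _ _ hx', mul_div_assoc]

theorem t₂_eq (hF : deriv f α ≠ 0) (x : ℝ) :
    t₂ f G x = normDivDiff f α (wStep f G x) (yStep f x) / normDivDiff f α (wStep f G x) x := by
  rw [t₂, normDivDiff, normDivDiff, div_div_div_cancel_right₀ hF]

/-! ### Expansions of the first stage -/

theorem hasExpansion_self (hf : TimesDifferentiableAt 6 f α) (hF : deriv f α ≠ 0) :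
    HasExpansion α (fun x => normDivDiff f α x α) 1 (coeff f α 2) (coeff f α 3) (coeff f α 4)
      (coeff f α 5) :=
  (HasExpansion.divDiff_comp hf hF (HasExpansion.sub_self α)
    ((HasExpansion.const α 0).congr_fun (v := fun _ => α - α) (by simp))).congr_coeff rfl
    (by ring) (by ring) (by ring) (by ring)

theorem hasExpansion_zStep (hf : TimesDifferentiableAt 6 f α) (hroot : f α = 0)
    (hF : deriv f α ≠ 0) :
    HasExpansion α (fun x => zStep f x - α) 0 1 0 (deriv f α ^ 3)
      (3 * deriv f α ^ 3 * coeff f α 2) := by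
  have h := (HasExpansion.sub_self α).mul (hasExpansion_self hf hF)
  have h' := (HasExpansion.sub_self α).add
    ((HasExpansion.const α (deriv f α ^ 3)).mul (h.mul (h.mul h)))
  refine (h'.congr_fun fun x => ?_).congr_coeff (by ring) (by ring) (by ring) (by ring) (by ring)
  rw [zStep, eq_mul_normDivDiff hroot hF x]
  ring

theorem hasExpansion_normDivDiff_zStep (hf : TimesDifferentiableAt 6 f α) (hroot : f α = 0)
    (hF : deriv f α ≠ 0) :
    HasExpansion α (fun x => normDivDiff f α (zStep f x) x) 1 (2 * coeff f α 2)
      (3 * coeff f α 3) (deriv f α ^ 3 * coeff f α 2 + 4 * coeff f α 4)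
      (3 * deriv f α ^ 3 * coeff f α 2 ^ 2 + 3 * deriv f α ^ 3 * coeff f α 3
        + 5 * coeff f α 5) :=
  (HasExpansion.divDiff_comp hf hF (hasExpansion_zStep hf hroot hF)
    (HasExpansion.sub_self α)).congr_coeff rfl (by ring) (by ring) (by ring) (by ring)

theorem hasExpansion_yFactor (hf : TimesDifferentiableAt 6 f α) (hroot : f α = 0)
    (hF : deriv f α ≠ 0) :
    HasExpansion α (yFactor f α) 0 (coeff f α 2) (-2 * coeff f α 2 ^ 2 + 2 * coeff f α 3)
      (deriv f α ^ 3 * coeff f α 2 + 4 * coeff f α 2 ^ 3 - 7 * coeff f α 2 * coeff f α 3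
        + 3 * coeff f α 4)
      (3 * deriv f α ^ 3 * coeff f α 3 - 8 * coeff f α 2 ^ 4
        + 20 * coeff f α 2 ^ 2 * coeff f α 3 - 10 * coeff f α 2 * coeff f α 4
        - 6 * coeff f α 3 ^ 2 + 4 * coeff f α 5) := by
  have h := (hasExpansion_self hf hF).div (hasExpansion_normDivDiff_zStep hf hroot hF)
    (c₀ := 1) (c₁ := -coeff f α 2) (c₂ := 2 * coeff f α 2 ^ 2 - 2 * coeff f α 3)
    (c₃ := -deriv f α ^ 3 * coeff f α 2 - 4 * coeff f α 2 ^ 3 + 7 * coeff f α 2 * coeff f α 3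
      - 3 * coeff f α 4)
    (c₄ := -3 * deriv f α ^ 3 * coeff f α 3 + 8 * coeff f α 2 ^ 4
      - 20 * coeff f α 2 ^ 2 * coeff f α 3 + 10 * coeff f α 2 * coeff f α 4
      + 6 * coeff f α 3 ^ 2 - 4 * coeff f α 5)
    (by ring) (by ring) (by ring) (by ring) (by ring)
  exact (((HasExpansion.const α 1).sub h).congr_fun fun _ => rfl).congr_coeff (by ring) (by ring)
    (by ring) (by ring) (by ring)

theorem hasExpansion_yStep (hf : TimesDifferentiableAt 6 f α) (hroot : f α = 0)
    (hF : deriv f α ≠ 0) :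
    HasExpansion α (fun x => yStep f x - α) 0 0 (coeff f α 2)
      (-2 * coeff f α 2 ^ 2 + 2 * coeff f α 3)
      (deriv f α ^ 3 * coeff f α 2 + 4 * coeff f α 2 ^ 3 - 7 * coeff f α 2 * coeff f α 3
        + 3 * coeff f α 4) :=
  (((HasExpansion.sub_self α).mul (hasExpansion_yFactor hf hroot hF)).congr_fun
    (yStep_sub_eq hroot hF)).congr_coeff (by ring) (by ring) (by ring) (by ring) (by ring)

/-! ### Expansions of the second stage -/

theorem hasExpansion_normDivDiff_yStep_root (hf : TimesDifferentiableAt 6 f α)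
    (hroot : f α = 0) (hF : deriv f α ≠ 0) :
    HasExpansion α (fun x => normDivDiff f α (yStep f x) α) 1 0 (coeff f α 2 ^ 2)
      (-2 * coeff f α 2 ^ 3 + 2 * coeff f α 2 * coeff f α 3)
      (deriv f α ^ 3 * coeff f α 2 ^ 2 + 4 * coeff f α 2 ^ 4
        - 6 * coeff f α 2 ^ 2 * coeff f α 3 + 3 * coeff f α 2 * coeff f α 4) :=
  (HasExpansion.divDiff_comp hf hF (hasExpansion_yStep hf hroot hF)
    ((HasExpansion.const α 0).congr_fun (v := fun _ => α - α) (by simp))).congr_coeff rfl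
    (by ring) (by ring) (by ring) (by ring)

theorem hasExpansion_normDivDiff_self_yStep (hf : TimesDifferentiableAt 6 f α)
    (hroot : f α = 0) (hF : deriv f α ≠ 0) :
    HasExpansion α (fun x => normDivDiff f α x (yStep f x)) 1 (coeff f α 2)
      (coeff f α 2 ^ 2 + coeff f α 3)
      (-2 * coeff f α 2 ^ 3 + 3 * coeff f α 2 * coeff f α 3 + coeff f α 4)
      (deriv f α ^ 3 * coeff f α 2 ^ 2 + 4 * coeff f α 2 ^ 4
        - 8 * coeff f α 2 ^ 2 * coeff f α 3 + 4 * coeff f α 2 * coeff f α 4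
        + 2 * coeff f α 3 ^ 2 + coeff f α 5) :=
  (HasExpansion.divDiff_comp hf hF (HasExpansion.sub_self α)
    (hasExpansion_yStep hf hroot hF)).congr_coeff rfl (by ring) (by ring) (by ring) (by ring)

theorem hasExpansion_normDivDiff_yStep_ratio (hf : TimesDifferentiableAt 6 f α)
    (hroot : f α = 0) (hF : deriv f α ≠ 0) :
    HasExpansion α (fun x => normDivDiff f α (yStep f x) α / normDivDiff f α x (yStep f x)) 1
      (-coeff f α 2) (coeff f α 2 ^ 2 - coeff f α 3) (coeff f α 2 * coeff f α 3 - coeff f α 4)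
      (-3 * coeff f α 2 ^ 4 + 4 * coeff f α 2 ^ 2 * coeff f α 3 + coeff f α 2 * coeff f α 4
        - coeff f α 3 ^ 2 - coeff f α 5) :=
  (hasExpansion_normDivDiff_yStep_root hf hroot hF).div
    (hasExpansion_normDivDiff_self_yStep hf hroot hF)
    (by ring) (by ring) (by ring) (by ring) (by ring)

/-- The second factor is needed only up to `O((x - α)^3)`, so the last two coefficients are left
unspecified. -/
theorem hasExpansion_t₁ (hf : TimesDifferentiableAt 6 f α) (hroot : f α = 0)
    (hF : deriv f α ≠ 0) :
    ∃ a₃ a₄, HasExpansion α (t₁ f) 0 (coeff f α 2) (-3 * coeff f α 2 ^ 2 + 2 * coeff f α 3)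
      a₃ a₄ := by
  have h := (hasExpansion_normDivDiff_yStep_root hf hroot hF).div (hasExpansion_self hf hF)
    (c₀ := 1) (c₁ := -coeff f α 2) (c₂ := 2 * coeff f α 2 ^ 2 - coeff f α 3)
    (c₃ := -4 * coeff f α 2 ^ 3 + 4 * coeff f α 2 * coeff f α 3 - coeff f α 4)
    (c₄ := deriv f α ^ 3 * coeff f α 2 ^ 2 + 8 * coeff f α 2 ^ 4
      - 12 * coeff f α 2 ^ 2 * coeff f α 3 + 5 * coeff f α 2 * coeff f α 4
      + coeff f α 3 ^ 2 - coeff f α 5)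
    (by ring) (by ring) (by ring) (by ring) (by ring)
  exact ⟨_, _, (((hasExpansion_yFactor hf hroot hF).mul h).congr_fun
    (t₁_eq hroot hF)).congr_coeff (by ring) (by ring) (by ring) rfl rfl⟩

/-! ### Taylor expansions of the weights -/

theorem taylor_isBigO_of_timesDifferentiableAt_three (hG : TimesDifferentiableAt 3 G 0)
    (hG0 : G 0 = 1) (hG1 : deriv G 0 = 1) :
    (fun t => G t - (1 + t + iteratedDeriv 2 G 0 / 2 * t ^ 2)) =O[𝓝 0] fun t => t ^ 3 := by
  have h1 := hG.taylor_isLittleO.isBigO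
  have h2 := (isBigO_refl (fun t : ℝ => t ^ 3) (𝓝 0)).const_mul_left (iteratedDeriv 3 G 0 / 6)
  simp only [sub_zero] at h1
  refine (h1.add h2).congr_left fun t => ?_
  simp only [Finset.sum_range_succ, Finset.range_zero, Finset.sum_empty, Nat.factorial,
    iteratedDeriv_zero, iteratedDeriv_one, hG0, hG1]
  push_cast
  ring

theorem taylor_isLittleO_of_timesDifferentiableAt_four (hH : TimesDifferentiableAt 4 H 1)
    (hH0 : H 1 = 1) (hH1 : deriv H 1 = 0) (hH2 : iteratedDeriv 2 H 1 = 2)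
    (hH3 : iteratedDeriv 3 H 1 = -12) :
    (fun t => H t - (1 + (t - 1) ^ 2 - 2 * (t - 1) ^ 3 + iteratedDeriv 4 H 1 / 24 * (t - 1) ^ 4))
      =o[𝓝 1] fun t => (t - 1) ^ 4 := by
  refine hH.taylor_isLittleO.congr_left fun t => ?_
  simp only [Finset.sum_range_succ, Finset.range_zero, Finset.sum_empty, Nat.factorial,
    iteratedDeriv_zero, iteratedDeriv_one, hH0, hH1, hH2, hH3]
  push_cast
  ring

theorem taylor_isBigO_of_timesDifferentiableAt_five (hH : TimesDifferentiableAt 5 H 1)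
    (hH0 : H 1 = 1) (hH1 : deriv H 1 = 0) (hH2 : iteratedDeriv 2 H 1 = 2)
    (hH3 : iteratedDeriv 3 H 1 = -12) :
    (fun t => H t - (1 + (t - 1) ^ 2 - 2 * (t - 1) ^ 3 + iteratedDeriv 4 H 1 / 24 * (t - 1) ^ 4))
      =O[𝓝 1] fun t => (t - 1) ^ 5 := by
  have h2 := (isBigO_refl (fun t : ℝ => (t - 1) ^ 5) (𝓝 1)).const_mul_left
    (iteratedDeriv 5 H 1 / 120)
  refine (hH.taylor_isLittleO.isBigO.add h2).congr_left fun t => ?_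
  simp only [Finset.sum_range_succ, Finset.range_zero, Finset.sum_empty, Nat.factorial,
    iteratedDeriv_zero, iteratedDeriv_one, hH0, hH1, hH2, hH3]
  push_cast
  ring

/-! ### Error of the second stage -/

/-- The first-order terms of `G(t₁) = 1 + c₂ e + ⋯` and of the quotient `1 - c₂ e + ⋯` cancel in the
product. The Taylor remainder of `G` contributes `O(t₁^3)`, which is `O(e^3)`. -/
theorem wFactor_isBigO (hf : TimesDifferentiableAt 6 f α) (hroot : f α = 0)
    (hF : deriv f α ≠ 0) (hG : TimesDifferentiableAt 3 G 0) (hG0 : G 0 = 1)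
    (hG1 : deriv G 0 = 1) :
    (fun x => wFactor f G α x - ((3 - iteratedDeriv 2 G 0 / 2) * coeff f α 2 ^ 2 - coeff f α 3)
      * (x - α) ^ 2) =O[𝓝 α] fun x => (x - α) ^ 3 := by
  obtain ⟨a₃, a₄, ht⟩ := hasExpansion_t₁ hf hroot hF
  have hs := hasExpansion_normDivDiff_yStep_ratio hf hroot hF
  have hp := (HasExpansion.const α 1).sub ((((HasExpansion.const α 1).add ht).add
    ((HasExpansion.const α (iteratedDeriv 2 G 0 / 2)).mul (ht.mul ht))).mul hs)
  have hp' := (hp.congr_coeff (b₀ := 0) (b₁ := 0)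
    (b₂ := (3 - iteratedDeriv 2 G 0 / 2) * coeff f α 2 ^ 2 - coeff f α 3)
    (by ring) (by ring) (by ring) rfl rfl).isBigO_sub_two
  have hr := ((taylor_isBigO_of_timesDifferentiableAt_three hG hG0 hG1).comp_tendsto
    ht.tendsto).trans (ht.isBigO_sub_self.pow 3)
  have hr' := hr.mul hs.isBigO_one
  simp only [mul_one, Function.comp_apply] at hr'
  refine (hp'.sub hr').congr_left fun x => ?_
  rw [wFactor]
  ring

theorem hasExpansion_wStep (hf : TimesDifferentiableAt 6 f α) (hroot : f α = 0)
    (hF : deriv f α ≠ 0) (hG : TimesDifferentiableAt 3 G 0) (hG0 : G 0 = 1)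
    (hG1 : deriv G 0 = 1) :
    HasExpansion α (fun x => wStep f G x - α) 0 0 0 0
      (coeff f α 2 * ((3 - iteratedDeriv 2 G 0 / 2) * coeff f α 2 ^ 2 - coeff f α 3)) := by
  have hw := wFactor_isBigO hf hroot hF hG hG0 hG1
  have hy := (hasExpansion_yStep hf hroot hF).isBigO_sub_two
  set B := (3 - iteratedDeriv 2 G 0 / 2) * coeff f α 2 ^ 2 - coeff f α 3 with hB
  have hw2 : wFactor f G α =O[𝓝 α] fun x => (x - α) ^ 2 := by
    have := (hw.trans (isBigO_sub_pow (m := 2) (by norm_num))).add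
      ((isBigO_refl (fun x : ℝ => (x - α) ^ 2) (𝓝 α)).const_mul_left B)
    exact this.congr_left fun x => by ring
  -- With `Y = y - α`, `W` the factor and `e = x - α`: `Y W - c₂ B e^4 = (Y - c₂ e^2) W + c₂ e^2 (W
  -- - B e^2)`, so one extra order in each factor gives `O(e^5)`.
  have h1 := hy.mul hw2
  have h2 := ((isBigO_refl (fun x : ℝ => (x - α) ^ 2) (𝓝 α)).const_mul_left (coeff f α 2)).mul hw
  simp only [← pow_add] at h1 h2
  refine (h1.add h2).congr_left fun x => ?_
  beta_reduce
  rw [wStep_sub_eq hroot hF]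
  ring

/-! ### Third stage and the error equation -/

theorem hasExpansion_normDivDiff_wStep_root (hf : TimesDifferentiableAt 6 f α) (hroot : f α = 0)
    (hF : deriv f α ≠ 0) (hG : TimesDifferentiableAt 3 G 0) (hG0 : G 0 = 1)
    (hG1 : deriv G 0 = 1) :
    HasExpansion α (fun x => normDivDiff f α (wStep f G x) α) 1 0 0 0
      (coeff f α 2 * (coeff f α 2 *
        ((3 - iteratedDeriv 2 G 0 / 2) * coeff f α 2 ^ 2 - coeff f α 3))) :=
  (HasExpansion.divDiff_comp hf hF (hasExpansion_wStep hf hroot hF hG hG0 hG1)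
    ((HasExpansion.const α 0).congr_fun (v := fun _ => α - α) (by simp))).congr_coeff rfl
    (by ring) (by ring) (by ring) (by ring)

theorem hasExpansion_normDivDiff_wStep_self (hf : TimesDifferentiableAt 6 f α) (hroot : f α = 0)
    (hF : deriv f α ≠ 0) (hG : TimesDifferentiableAt 3 G 0) (hG0 : G 0 = 1)
    (hG1 : deriv G 0 = 1) :
    HasExpansion α (fun x => normDivDiff f α (wStep f G x) x) 1 (coeff f α 2) (coeff f α 3)
      (coeff f α 4) (coeff f α 2 * (coeff f α 2 *
        ((3 - iteratedDeriv 2 G 0 / 2) * coeff f α 2 ^ 2 - coeff f α 3)) + coeff f α 5) :=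
  (HasExpansion.divDiff_comp hf hF (hasExpansion_wStep hf hroot hF hG hG0 hG1)
    (HasExpansion.sub_self α)).congr_coeff rfl (by ring) (by ring) (by ring) (by ring)

theorem hasExpansion_normDivDiff_wStep_yStep (hf : TimesDifferentiableAt 6 f α)
    (hroot : f α = 0) (hF : deriv f α ≠ 0) (hG : TimesDifferentiableAt 3 G 0) (hG0 : G 0 = 1)
    (hG1 : deriv G 0 = 1) :
    HasExpansion α (fun x => normDivDiff f α (wStep f G x) (yStep f x)) 1 0 (coeff f α 2 ^ 2)
      (-2 * coeff f α 2 ^ 3 + 2 * coeff f α 2 * coeff f α 3)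
      (coeff f α 2 * (coeff f α 2 *
        ((3 - iteratedDeriv 2 G 0 / 2) * coeff f α 2 ^ 2 - coeff f α 3))
        + deriv f α ^ 3 * coeff f α 2 ^ 2 + 4 * coeff f α 2 ^ 4
        - 6 * coeff f α 2 ^ 2 * coeff f α 3 + 3 * coeff f α 2 * coeff f α 4) :=
  (HasExpansion.divDiff_comp hf hF (hasExpansion_wStep hf hroot hF hG hG0 hG1)
    (hasExpansion_yStep hf hroot hF)).congr_coeff rfl (by ring) (by ring) (by ring) (by ring)

theorem hasExpansion_t₂_sub_one (hf : TimesDifferentiableAt 6 f α)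
    (hroot : f α = 0) (hF : deriv f α ≠ 0) (hG : TimesDifferentiableAt 3 G 0) (hG0 : G 0 = 1)
    (hG1 : deriv G 0 = 1) :
    HasExpansion α (fun x => t₂ f G x - 1) 0 (-coeff f α 2) (2 * coeff f α 2 ^ 2 - coeff f α 3)
      (-4 * coeff f α 2 ^ 3 + 4 * coeff f α 2 * coeff f α 3 - coeff f α 4)
      (deriv f α ^ 3 * coeff f α 2 ^ 2 + 8 * coeff f α 2 ^ 4
        - 12 * coeff f α 2 ^ 2 * coeff f α 3 + 5 * coeff f α 2 * coeff f α 4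
        + coeff f α 3 ^ 2 - coeff f α 5) := by
  have h := (hasExpansion_normDivDiff_wStep_yStep hf hroot hF hG hG0 hG1).div
    (hasExpansion_normDivDiff_wStep_self hf hroot hF hG hG0 hG1)
    (c₀ := 1) (c₁ := -coeff f α 2) (c₂ := 2 * coeff f α 2 ^ 2 - coeff f α 3)
    (c₃ := -4 * coeff f α 2 ^ 3 + 4 * coeff f α 2 * coeff f α 3 - coeff f α 4)
    (c₄ := deriv f α ^ 3 * coeff f α 2 ^ 2 + 8 * coeff f α 2 ^ 4
        - 12 * coeff f α 2 ^ 2 * coeff f α 3 + 5 * coeff f α 2 * coeff f α 4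
        + coeff f α 3 ^ 2 - coeff f α 5)
    (by ring) (by ring) (by ring) (by ring) (by ring)
  refine ((h.sub (HasExpansion.const α 1)).congr_fun fun x => ?_).congr_coeff
    (by ring) (by ring) (by ring) (by ring) (by ring)
  rw [t₂_eq hF]

theorem hasExpansion_normDivDiff_wStep_ratio (hf : TimesDifferentiableAt 6 f α)
    (hroot : f α = 0) (hF : deriv f α ≠ 0) (hG : TimesDifferentiableAt 3 G 0) (hG0 : G 0 = 1)
    (hG1 : deriv G 0 = 1) :
    HasExpansion α
      (fun x => normDivDiff f α (wStep f G x) α / normDivDiff f α (wStep f G x) (yStep f x)) 1 0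
      (-coeff f α 2 ^ 2) (2 * coeff f α 2 ^ 3 - 2 * coeff f α 2 * coeff f α 3)
      (-deriv f α ^ 3 * coeff f α 2 ^ 2 - 3 * coeff f α 2 ^ 4
        + 6 * coeff f α 2 ^ 2 * coeff f α 3 - 3 * coeff f α 2 * coeff f α 4) :=
  (hasExpansion_normDivDiff_wStep_root hf hroot hF hG hG0 hG1).div
    (hasExpansion_normDivDiff_wStep_yStep hf hroot hF hG hG0 hG1)
    (by ring) (by ring) (by ring) (by ring) (by ring)

/-- Up to the remainder in Taylor's formula for `H`, the last stage multiplies the error by a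
multiple of `(x - α)^4`. -/
theorem stepFactor_add_isBigO (hf : TimesDifferentiableAt 6 f α)
    (hroot : f α = 0) (hF : deriv f α ≠ 0) (hG : TimesDifferentiableAt 3 G 0) (hG0 : G 0 = 1)
    (hG1 : deriv G 0 = 1) (q : ℝ) :
    (fun x => stepFactor f G H α x + (H (t₂ f G x) - (1 + (t₂ f G x - 1) ^ 2
        - 2 * (t₂ f G x - 1) ^ 3 + q * (t₂ f G x - 1) ^ 4)) *
        (normDivDiff f α (wStep f G x) α / normDivDiff f α (wStep f G x) (yStep f x))
      - (deriv f α ^ 3 * coeff f α 2 ^ 2 - coeff f α 2 ^ 4 * q + 4 * coeff f α 2 ^ 4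
        + coeff f α 2 * coeff f α 4 - coeff f α 3 ^ 2) * (x - α) ^ 4)
      =O[𝓝 α] fun x => (x - α) ^ 5 := by
  have ht := hasExpansion_t₂_sub_one hf hroot hF hG hG0 hG1
  have hr := hasExpansion_normDivDiff_wStep_ratio hf hroot hF hG hG0 hG1
  have ht2 := ht.mul ht
  have hp := (((HasExpansion.const α 1).add ht2).sub
    ((HasExpansion.const α 2).mul (ht2.mul ht))).add ((HasExpansion.const α q).mul (ht2.mul ht2))
  -- The part `1 + s^2 - 2 s^3` of `H`, with `s = t₂ - 1`, expands as `1 + c₂^2 e^2 + (2 c₂ c₃ - 2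
  -- c₂^3) e^3 + ⋯`, which cancels the quotient's terms of order two and three. The term `q s^4`
  -- first acts at order four.
  have h := ((HasExpansion.const α 1).sub (hp.mul hr)).congr_coeff (b₀ := 0) (b₁ := 0) (b₂ := 0)
    (b₃ := 0) (b₄ := deriv f α ^ 3 * coeff f α 2 ^ 2 - coeff f α 2 ^ 4 * q + 4 * coeff f α 2 ^ 4
        + coeff f α 2 * coeff f α 4 - coeff f α 3 ^ 2)
    (by ring) (by ring) (by ring) (by ring) (by ring)
  refine h.isBigO_sub_four.congr_left fun x => ?_
  rw [stepFactor]
  ring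

/-- The constant is the leading coefficient of `w - α` times that of `stepFactor`. -/
theorem errorConst_eq (f G H : ℝ → ℝ) (α : ℝ) : errorConst f G H α =
    (coeff f α 2 * ((3 - iteratedDeriv 2 G 0 / 2) * coeff f α 2 ^ 2 - coeff f α 3)) *
    (deriv f α ^ 3 * coeff f α 2 ^ 2 - coeff f α 2 ^ 4 * (iteratedDeriv 4 H 1 / 24)
      + 4 * coeff f α 2 ^ 4 + coeff f α 2 * coeff f α 4 - coeff f α 3 ^ 2) := by
  rw [errorConst]
  ring

theorem tendsto_t₂ (hf : TimesDifferentiableAt 6 f α)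
    (hroot : f α = 0) (hF : deriv f α ≠ 0) (hG : TimesDifferentiableAt 3 G 0) (hG0 : G 0 = 1)
    (hG1 : deriv G 0 = 1) : Tendsto (t₂ f G) (𝓝 α) (𝓝 1) := by
  simpa using (hasExpansion_t₂_sub_one hf hroot hF hG hG0 hG1).tendsto.add_const 1

theorem wStep_sub_isBigO (hf : TimesDifferentiableAt 6 f α)
    (hroot : f α = 0) (hF : deriv f α ≠ 0) (hG : TimesDifferentiableAt 3 G 0) (hG0 : G 0 = 1)
    (hG1 : deriv G 0 = 1) : (fun x => wStep f G x - α) =O[𝓝 α] fun x => (x - α) ^ 4 := by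
  have h := hasExpansion_wStep hf hroot hF hG hG0 hG1
  have := (h.isBigO_sub_four.trans (isBigO_sub_pow (m := 4) (by norm_num))).add
    ((isBigO_refl (fun x : ℝ => (x - α) ^ 4) (𝓝 α)).const_mul_left
      (coeff f α 2 * ((3 - iteratedDeriv 2 G 0 / 2) * coeff f α 2 ^ 2 - coeff f α 3)))
  exact this.congr_left fun x => by ring

/-- The error equation of one step. -/
theorem step_error_isLittleO (hf : TimesDifferentiableAt 6 f α) (hroot : f α = 0)
    (hF : deriv f α ≠ 0) (hG : TimesDifferentiableAt 3 G 0) (hG0 : G 0 = 1)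
    (hG1 : deriv G 0 = 1) (hH : TimesDifferentiableAt 4 H 1)
    (hH0 : H 1 = 1) (hH1 : deriv H 1 = 0) (hH2 : iteratedDeriv 2 H 1 = 2)
    (hH3 : iteratedDeriv 3 H 1 = -12) :
    (fun x => step f G H x - α - errorConst f G H α * (x - α) ^ 8)
      =o[𝓝 α] fun x => (x - α) ^ 8 := by
  have ht := hasExpansion_t₂_sub_one hf hroot hF hG hG0 hG1
  have hw := (hasExpansion_wStep hf hroot hF hG hG0 hG1).isBigO_sub_four
  have hw4 := wStep_sub_isBigO hf hroot hF hG hG0 hG1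
  have hs := stepFactor_add_isBigO (H := H) hf hroot hF hG hG0 hG1 (iteratedDeriv 4 H 1 / 24)
  have hρ := (((taylor_isLittleO_of_timesDifferentiableAt_four hH hH0 hH1 hH2 hH3).comp_tendsto
    (tendsto_t₂ hf hroot hF hG hG0 hG1)).trans_isBigO (ht.isBigO_sub_self.pow 4)).mul_isBigO
    (hasExpansion_normDivDiff_wStep_ratio hf hroot hF hG hG0 hG1).isBigO_one
  have h45 : (fun x : ℝ => (x - α) ^ 5) =o[𝓝 α] fun x => (x - α) ^ 4 := by
    have := (isBigO_refl (fun x : ℝ => (x - α) ^ 4) (𝓝 α)).mul_isLittleO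
      ((isLittleO_one_iff ℝ).2 (tendsto_sub_self α))
    simpa [pow_succ] using this
  simp only [mul_one, Function.comp_apply] at hρ
  -- With `W = w - α ~ A e^4` and last factor `S ~ C e^4`: `W S - A C e^8 = W (S - C e^4) + C e^4 (W
  -- - A e^4)`. The remainder of `H` is `o((t₂ - 1)^4)`, hence `o(e^4)`.
  have h1 := hw4.mul_isLittleO ((hs.trans_isLittleO h45).sub hρ)
  have h2 := (hw.trans_isLittleO h45).mul_isBigO
    ((isBigO_refl (fun x : ℝ => (x - α) ^ 4) (𝓝 α)).const_mul_left
    (deriv f α ^ 3 * coeff f α 2 ^ 2 - coeff f α 2 ^ 4 * (iteratedDeriv 4 H 1 / 24)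
      + 4 * coeff f α 2 ^ 4 + coeff f α 2 * coeff f α 4 - coeff f α 3 ^ 2))
  simp only [← pow_add] at h1 h2
  refine (h1.add h2).congr_left fun x => ?_
  rw [step_sub_eq hroot hF, errorConst_eq]
  ring

/-- The sharper error equation for a function `H` that is five times differentiable. -/
theorem step_error_isBigO (hf : TimesDifferentiableAt 6 f α) (hroot : f α = 0)
    (hF : deriv f α ≠ 0) (hG : TimesDifferentiableAt 3 G 0) (hG0 : G 0 = 1)
    (hG1 : deriv G 0 = 1) (hH : TimesDifferentiableAt 5 H 1)
    (hH0 : H 1 = 1) (hH1 : deriv H 1 = 0) (hH2 : iteratedDeriv 2 H 1 = 2)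
    (hH3 : iteratedDeriv 3 H 1 = -12) :
    (fun x => step f G H x - α - errorConst f G H α * (x - α) ^ 8)
      =O[𝓝 α] fun x => (x - α) ^ 9 := by
  have ht := hasExpansion_t₂_sub_one hf hroot hF hG hG0 hG1
  have hw := (hasExpansion_wStep hf hroot hF hG hG0 hG1).isBigO_sub_four
  have hw4 := wStep_sub_isBigO hf hroot hF hG hG0 hG1
  have hs := stepFactor_add_isBigO (H := H) hf hroot hF hG hG0 hG1 (iteratedDeriv 4 H 1 / 24)
  have hρ := (((taylor_isBigO_of_timesDifferentiableAt_five hH hH0 hH1 hH2 hH3).comp_tendsto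
    (tendsto_t₂ hf hroot hF hG hG0 hG1)).trans (ht.isBigO_sub_self.pow 5)).mul
    (hasExpansion_normDivDiff_wStep_ratio hf hroot hF hG hG0 hG1).isBigO_one
  simp only [mul_one, Function.comp_apply] at hρ
  have h1 := hw4.mul (hs.sub hρ)
  have h2 := hw.mul ((isBigO_refl (fun x : ℝ => (x - α) ^ 4) (𝓝 α)).const_mul_left
    (deriv f α ^ 3 * coeff f α 2 ^ 2 - coeff f α 2 ^ 4 * (iteratedDeriv 4 H 1 / 24)
      + 4 * coeff f α 2 ^ 4 + coeff f α 2 * coeff f α 4 - coeff f α 3 ^ 2))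
  simp only [← pow_add] at h1 h2
  refine (h1.add h2).congr_left fun x => ?_
  rw [step_sub_eq hroot hF, errorConst_eq]
  ring

end Stages

/-! ### Local convergence -/

section Convergence

variable {f G H : ℝ → ℝ} {α : ℝ}

theorem divDiff_ne_zero_of_normDivDiff {s t : ℝ} (h : normDivDiff f α s t ≠ 0) :
    divDiff f s t ≠ 0 := fun h0 => h (by rw [normDivDiff, h0, zero_div])

/-- All normalised divided differences tend to 1, and `z`, `y`, `w` tend to `α`. The nodes are
distinct because `z - x = f(x)^3`, `y - x` is a nonzero multiple of `f x`, and `w - y` is a multiple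
of `f y` with `G(t₁) → 1`. Finally `w = x ≠ α` would force `yFactor * wFactor = 1`, although this
product tends to 0. -/
theorem eventually_stepDefined {D : Set ℝ} (hD : D ∈ 𝓝 α) (hf : TimesDifferentiableAt 6 f α)
    (hroot : f α = 0) (hF : deriv f α ≠ 0) (hG : TimesDifferentiableAt 3 G 0) (hG0 : G 0 = 1)
    (hG1 : deriv G 0 = 1) :
    ∀ᶠ x in 𝓝 α, StepDefined D f G x ∧ (f x = 0 → x = α) := by
  have hz := hasExpansion_zStep hf hroot hF
  have hy := hasExpansion_yStep hf hroot hF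
  have hw := hasExpansion_wStep hf hroot hF hG hG0 hG1
  obtain ⟨a₃, a₄, ht⟩ := hasExpansion_t₁ hf hroot hF
  have mem : ∀ {u : ℝ → ℝ}, Tendsto (fun x => u x - α) (𝓝 α) (𝓝 0) → ∀ᶠ x in 𝓝 α, u x ∈ D := by
    intro u hu
    have : Tendsto u (𝓝 α) (𝓝 α) := by simpa using hu.add_const α
    exact this.eventually_mem hD
  have hGt : Tendsto (fun x => G (t₁ f x)) (𝓝 α) (𝓝 1) := by
    have hc : ContinuousAt G 0 := by
      simpa using (hG 0 (by norm_num)).1.continuousAt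
    rw [← hG0]
    exact hc.tendsto.comp ht.tendsto
  have hw0 : Tendsto (wFactor f G α) (𝓝 α) (𝓝 0) := by
    have := (hGt.mul (hasExpansion_normDivDiff_yStep_ratio hf hroot hF).tendsto).const_sub 1
    rw [mul_one, sub_self] at this
    exact this
  have hyw : Tendsto (fun x => yFactor f α x * wFactor f G α x) (𝓝 α) (𝓝 0) := by
    simpa using (hasExpansion_yFactor hf hroot hF).tendsto.mul hw0
  filter_upwards [hD, mem hz.tendsto, mem hy.tendsto, mem hw.tendsto,
    (hasExpansion_self hf hF).eventually_ne_zero,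
    (hasExpansion_normDivDiff_zStep hf hroot hF).eventually_ne_zero,
    (hasExpansion_normDivDiff_self_yStep hf hroot hF).eventually_ne_zero,
    (hasExpansion_normDivDiff_wStep_self hf hroot hF hG hG0 hG1).eventually_ne_zero,
    (hasExpansion_normDivDiff_wStep_yStep hf hroot hF hG hG0 hG1).eventually_ne_zero,
    hGt.eventually_ne one_ne_zero, hyw.eventually_ne zero_ne_one]
    with x h1 h2 h3 h4 h5 h6 h7 h8 h9 h10 h11
  have h6' := divDiff_ne_zero_of_normDivDiff h6
  have h7' := divDiff_ne_zero_of_normDivDiff h7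
  refine ⟨⟨⟨h1, h2, h3, h4⟩, ⟨h6', h7', divDiff_ne_zero_of_normDivDiff h8,
    divDiff_ne_zero_of_normDivDiff h9⟩, fun hx => ⟨?_, ?_, ?_⟩, fun hy0 => ?_⟩, fun hx => ?_⟩
  · simpa [zStep] using hx
  · simpa [yStep] using ⟨hx, h6'⟩
  · intro h
    have hxα : x - α ≠ 0 := fun h0 => hx (by rw [sub_eq_zero.1 h0, hroot])
    have h' := wStep_sub_eq (G := G) hroot hF x
    rw [h, yStep_sub_eq hroot hF, mul_assoc] at h'
    exact h11 (mul_left_cancel₀ hxα (by rw [← h', mul_one]))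
  · simpa [wStep] using ⟨h10, hy0, h7'⟩
  · rw [eq_mul_normDivDiff hroot hF x] at hx
    simpa [hF, h5, sub_eq_zero] using hx

/-- A step satisfying an error equation of order eight converges locally with that order. -/
theorem exists_local_convergence {D : Set ℝ} {ζ : ℝ}
    (hdef : ∀ᶠ x in 𝓝 α, StepDefined D f G x ∧ (f x = 0 → x = α))
    (herr : (fun x => step f G H x - α - ζ * (x - α) ^ 8) =o[𝓝 α] fun x => (x - α) ^ 8) :
    ∃ δ > 0, ∃ K : ℝ, ∀ x : ℕ → ℝ, |x 0 - α| < δ → (∀ n, x (n + 1) = step f G H (x n)) →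
      (∀ n, StepDefined D f G (x n) ∧ (f (x n) = 0 → x n = α)) ∧
      Tendsto x atTop (𝓝 α) ∧
      (∀ n, |x (n + 1) - α| ≤ K * |x n - α| ^ 8) ∧
      ((∀ n, x n ≠ α) → Tendsto (fun n => (x (n + 1) - α) / (x n - α) ^ 8) atTop (𝓝 ζ)) ∧
      (ζ ≠ 0 → x 0 ≠ α → HasConvergenceOrder x α 8 ζ) := by
  -- The summand 1 is the tolerance chosen in the little-o error equation.
  set K := |ζ| + 1 with hK
  have hbound : ∀ᶠ x in 𝓝 α, |step f G H x - α| ≤ K * |x - α| ^ 8 := by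
    filter_upwards [isLittleO_iff.1 herr one_pos] with x hx
    rw [Real.norm_eq_abs, Real.norm_eq_abs, abs_pow] at hx
    calc |step f G H x - α| = |(step f G H x - α - ζ * (x - α) ^ 8) + ζ * (x - α) ^ 8| := by
          rw [sub_add_cancel]
      _ ≤ 1 * |x - α| ^ 8 + |ζ| * |x - α| ^ 8 := by
          refine (abs_add_le _ _).trans (add_le_add hx ?_)
          rw [abs_mul, abs_pow]
      _ = K * |x - α| ^ 8 := by rw [hK]; ring
  -- Seven of the eight powers are spent on making the step halve the error, which keeps the
  -- iterates in the ball and forces convergence.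
  have hcontr : ∀ᶠ x in 𝓝 α, K * |x - α| ^ 7 < 1 / 2 := by
    have : Tendsto (fun x => K * |x - α| ^ 7) (𝓝 α) (𝓝 0) := by
      simpa using ((tendsto_sub_self α).abs.pow 7).const_mul K
    exact this.eventually_lt_const (by norm_num)
  have hne : ∀ᶠ x in 𝓝 α, ζ ≠ 0 → x ≠ α → step f G H x ≠ α := by
    by_cases h0 : ζ = 0
    · simp [h0]
    -- With tolerance `|ζ| / 2`, a step landing on `α` would give `|ζ| |e|^8 ≤ |ζ| |e|^8 / 2`,
    -- impossible for `e ≠ 0`.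
    · filter_upwards [isLittleO_iff.1 herr (half_pos (abs_pos.2 h0))] with x hx _ hxα hs
      have hpos : 0 < |ζ| * |(x - α) ^ 8| :=
        mul_pos (abs_pos.2 h0) (abs_pos.2 (pow_ne_zero 8 (sub_ne_zero.2 hxα)))
      rw [hs, sub_self, zero_sub, norm_neg, Real.norm_eq_abs, Real.norm_eq_abs, abs_mul] at hx
      linarith
  obtain ⟨δ, hδ, hball⟩ := Metric.eventually_nhds_iff_ball.1
    (hdef.and
      (hbound.and (hcontr.and hne)))
  refine ⟨δ, hδ, K, fun x hx0 hx => ?_⟩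
  have hhalf : ∀ t ∈ Metric.ball α δ, |step f G H t - α| ≤ 1 / 2 * |t - α| := by
    intro t ht
    obtain ⟨-, h1, h2, -⟩ := hball t ht
    refine h1.trans ?_
    rw [pow_succ, ← mul_assoc]
    exact mul_le_mul_of_nonneg_right h2.le (abs_nonneg _)
  have hmem : ∀ n, x n ∈ Metric.ball α δ := by
    intro n
    induction n with
    | zero => simpa [Real.dist_eq] using hx0
    | succ n ih =>
      have h := hhalf _ ih
      have h' : |x n - α| < δ := by simpa [Real.dist_eq] using ih
      rw [Metric.mem_ball, Real.dist_eq, hx n]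
      linarith [abs_nonneg (x n - α)]
  have hgeom : ∀ n, |x n - α| ≤ (1 / 2) ^ n * |x 0 - α| := by
    intro n
    induction n with
    | zero => simp
    | succ n ih =>
      have h := hhalf _ (hmem n)
      rw [hx n, pow_succ]
      linarith
  have hlim : Tendsto x atTop (𝓝 α) := by
    rw [tendsto_iff_dist_tendsto_zero]
    refine squeeze_zero (fun _ => dist_nonneg) (fun n => hgeom n) ?_
    simpa using (tendsto_pow_atTop_nhds_zero_of_lt_one (r := (1 / 2 : ℝ)) (by norm_num)
      (by norm_num)).mul_const |x 0 - α|
  have hratio : (∀ n, x n ≠ α) →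
      Tendsto (fun n => (x (n + 1) - α) / (x n - α) ^ 8) atTop (𝓝 ζ) := by
    intro hxα
    have h := ((herr.comp_tendsto hlim).tendsto_div_nhds_zero).add_const ζ
    rw [zero_add] at h
    refine h.congr fun n => ?_
    have hn : (x n - α) ^ 8 ≠ 0 := pow_ne_zero 8 (sub_ne_zero.2 (hxα n))
    simp only [Function.comp_apply, hx n]
    rw [sub_div, mul_div_cancel_right₀ _ hn, sub_add_cancel]
  refine ⟨fun n => (hball _ (hmem n)).1, hlim, fun n => ?_, hratio, fun h0 hx0' => ?_⟩
  · rw [hx n]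
    exact (hball _ (hmem n)).2.1
  · have hall : ∀ n, x n ≠ α := by
      intro n
      induction n with
      | zero => exact hx0'
      | succ n ih =>
        rw [hx n]
        exact (hball _ (hmem n)).2.2.2 h0 ih
    exact ⟨hlim, h0, hall, hratio hall⟩

end Convergence

end SteffensenEight

/-! ### The main theorem -/

theorem mainTheorem1 (D : Set ℝ) (f G H : ℝ → ℝ) (α : ℝ)
    (hD : D ∈ 𝓝 α) (hf : ContDiffOn ℝ 8 f D)
    (hroot : f α = 0) (hsimple : deriv f α ≠ 0)
    (hG : SteffensenEight.TimesDifferentiableAt 3 G 0)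
    (hG0 : G 0 = 1) (hG1 : deriv G 0 = 1)
    (hH : SteffensenEight.TimesDifferentiableAt 4 H 1)
    (hH0 : H 1 = 1) (hH1 : deriv H 1 = 0)
    (hH2 : iteratedDeriv 2 H 1 = 2) (hH3 : iteratedDeriv 3 H 1 = -12) :
    -- the error equation of one step
    ((fun x => SteffensenEight.step f G H x - α
        - SteffensenEight.errorConst f G H α * (x - α) ^ 8) =o[𝓝 α] fun x => (x - α) ^ 8) ∧
    (SteffensenEight.TimesDifferentiableAt 5 H 1 →
      (fun x => SteffensenEight.step f G H x - α
        - SteffensenEight.errorConst f G H α * (x - α) ^ 8) =O[𝓝 α] fun x => (x - α) ^ 9) ∧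
    -- local convergence of the iteration with order eight
    ∃ δ > 0, ∃ K : ℝ, ∀ x : ℕ → ℝ, |x 0 - α| < δ →
      (∀ n, x (n + 1) = SteffensenEight.step f G H (x n)) →
        (∀ n, SteffensenEight.StepDefined D f G (x n) ∧ (f (x n) = 0 → x n = α)) ∧
        Tendsto x atTop (𝓝 α) ∧
        (∀ n, |x (n + 1) - α| ≤ K * |x n - α| ^ 8) ∧
        ((∀ n, x n ≠ α) →
          Tendsto (fun n => (x (n + 1) - α) / (x n - α) ^ 8) atTop
            (𝓝 (SteffensenEight.errorConst f G H α))) ∧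
        (SteffensenEight.errorConst f G H α ≠ 0 → x 0 ≠ α →
          SteffensenEight.HasConvergenceOrder x α 8 (SteffensenEight.errorConst f G H α)) := by
  -- Smoothness of `f` enters the argument only through six-fold differentiability at `α`.
  have hf6 : SteffensenEight.TimesDifferentiableAt 6 f α :=
    ((hf.contDiffAt hD).timesDifferentiableAt (n := 8)).mono (by norm_num)
  have herr := SteffensenEight.step_error_isLittleO hf6 hroot hsimple hG hG0 hG1 hH hH0 hH1 hH2 hH3
  exact ⟨herr, fun hH5 =>
    SteffensenEight.step_error_isBigO hf6 hroot hsimple hG hG0 hG1 hH5 hH0 hH1 hH2 hH3,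
    SteffensenEight.exists_local_convergence
      (SteffensenEight.eventually_stepDefined hD hf6 hroot hsimple hG hG0 hG1) herr⟩
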